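/- For $\tau$ in the upper half plane put $q=e^{2\pi i\tau}$ and, for even $k\ge 2$, $$\mathbb{G}_k(\tau)=-\frac{B_k}{2k}+\sum_{n\ge 1}\sigma_{k-1}(n)q^n ,$$ where $B_k$ is the Bernoulli number and $\sigma_{k-1}(n)=\sum_{d\mid n}d^{k-1}$. Put $$\mathbb{G}_2^*(\tau)=\mathbb{G}_2(\tau)+\frac{1}{8\pi\,\mathrm{Im}\,\tau},\qquad \mathfrak{m}(\tau)=-8\pi\,\mathrm{Im}(\tau)\,\mathbb{G}_2^*(\tau),\qquad \mathfrak{m}(\overline{\tau}):=\overline{\mathfrak{m}(\tau)} .$$ For $\lambda\in\mathbb{C}^\times$ let $\mathcal{E}_{\tau,\lambda}$ be the elliptic curve $$y^2=4x^3-ux-v,\qquad u=20\,\lambda^{-4}\,\mathbb{G}_4(\tau),\quad v=\tfrac73\,\lambda^{-6}\,\mathbb{G}_6(\tau),$$ so that $\mathcal{E}_{\tau}=\mathcal{E}_{\tau,1}$ is the curve with $u=20\,\mathbb{G}_4(\tau)$, $v=\tfrac73\mathbb{G}_6(\tau)$. Let $\wp$ be the Weierstrass function of the lattice $\mathbb{Z}+\tau\mathbb{Z}$.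 Then the map $$z\mapsto (x,y)=\Big(\frac{\wp(z)}{(2\pi i\lambda)^{2}},\ \frac{\wp'(z)}{(2\pi i\lambda)^{3}}\Big)$$ sends $\mathbb{C}\setminus(\mathbb{Z}+\tau\mathbb{Z})$ into the affine curve $\mathcal{E}_{\tau,\lambda}$ (this is the classical uniformization of the curve by $\mathbb{C}/(\mathbb{Z}+\tau\mathbb{Z})$). Let $\gamma_1,\gamma_2$ be loops on the affine curve that correspond to the lattice vectors $1,\tau$, that is, which are the images of $C^1$ paths in $\mathbb{C}\setminus(\mathbb{Z}+\tau\mathbb{Z})$ from a point $z_1$ to $z_1+1$, respectively from a point $z_2$ to $z_2+\tau$. Let $$P=\begin{pmatrix}\omega_1&\eta_1\\ \omega_2&\eta_2\end{pmatrix},\qquad \omega_j=\int_{\gamma_j}\frac{dx}{y},\quad \eta_j=\int_{\gamma_j}x\,\frac{dx}{y} .$$ Then these integrals exist, $\omega_1=2\pi i\lambda$, $\omega_2=\tau\omega_1$, $P$ is invertible, and the single-valued period matrix $\overline{P}^{-1}P$ equals $$\begin{pmatrix}\overline{\lambda}^{-1}&0\\0&\overline{\lambda}\end{pmatrix} \begin{pmatrix}\mathfrak{m}(\overline{\tau})&(4\pi\,\mathrm{Im}\,\tau)^{-1}\big(\mathfrak{m}(\tau)\mathfrak{m}(\overline{\tau})-1\big)\\-4\pi\,\mathrm{Im}\,\tau&-\mathfrak{m}(\tau)\end{pmatrix}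 \begin{pmatrix}\lambda&0\\0&\lambda^{-1}\end{pmatrix}.$$ -/

import Mathlib

noncomputable section

namespace UniversalElliptic

/-- The normalised Eisenstein series
`𝔾_k(τ) = - B_k / (2k) + ∑_{n ≥ 1} σ_{k-1}(n) q ^ n`, where `q = exp (2πiτ)` and `B_k` is the
Bernoulli number.  The constant terms are `-1/24`, `1/240`, `-1/504` for `k = 2, 4, 6`. -/
def eisG (k : ℕ) (τ : UpperHalfPlane) : ℂ :=
  -((bernoulli k : ℚ) : ℂ) / (2 * (k : ℂ)) +
    ∑' n : ℕ+, (ArithmeticFunction.sigma (k - 1) (n : ℕ) : ℂ) *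
      Complex.exp (2 * Real.pi * Complex.I * (τ : ℂ)) ^ (n : ℕ)

/-- The real analytic modification `𝔾₂*(τ) = 𝔾₂(τ) + 1 / (8π Im τ)`. -/
def eisGTwoStar (τ : UpperHalfPlane) : ℂ :=
  eisG 2 τ + 1 / (8 * Real.pi * (τ.im : ℂ))

/-- `𝔪(τ) = - 8π Im(τ) 𝔾₂*(τ)`. -/
def frakM (τ : UpperHalfPlane) : ℂ :=
  -8 * Real.pi * (τ.im : ℂ) * eisGTwoStar τ

/-- The pair of periods `(1, τ)`, whose lattice is `ℤ + τℤ`. -/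
def periodPair (τ : UpperHalfPlane) : PeriodPair where
  ω₁ := 1
  ω₂ := (τ : ℂ)
  indep := by
    rw [LinearIndependent.pair_iff]
    intro s t h
    have him := congrArg Complex.im h
    have hre := congrArg Complex.re h
    simp at him hre
    rcases him with ht | ht
    · subst ht
      simpa using hre
    · exact absurd ht τ.im_pos.ne'

/-- The complex points of the affine curve `y² = 4x³ - ux - v`
(an elliptic curve without its origin when the cubic has distinct roots). -/
def affineCurve (u v : ℂ) : Set (ℂ × ℂ) :=
  {P | P.2 ^ 2 = 4 * P.1 ^ 3 - u * P.1 - v}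

/-- The coefficient `u = 20 𝔾₄(τ) λ⁻⁴`. -/
def coeffU (τ : UpperHalfPlane) (lam : ℂ) : ℂ := 20 * eisG 4 τ / lam ^ 4

/-- The coefficient `v = (7/3) 𝔾₆(τ) λ⁻⁶`. -/
def coeffV (τ : UpperHalfPlane) (lam : ℂ) : ℂ := 7 / 3 * eisG 6 τ / lam ^ 6

/-- The Weierstrass uniformisation, off the lattice `ℤ + τℤ`, of the curve with coefficients
`coeffU τ lam`, `coeffV τ lam`: with `c = 2πiλ`, it is
`z ↦ (c⁻² ℘(z), c⁻³ ℘'(z)) = (℘_{c(ℤ + τℤ)}(cz), ℘'_{c(ℤ + τℤ)}(cz))`. -/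
def uniformization (τ : UpperHalfPlane) (lam : ℂ) (z : ℂ) : ℂ × ℂ :=
  ((periodPair τ).weierstrassP z / (2 * Real.pi * Complex.I * lam) ^ 2,
    (periodPair τ).derivWeierstrassP z / (2 * Real.pi * Complex.I * lam) ^ 3)

/-- The loop `γ` on the punctured curve corresponds to the lattice vector `w`: it lifts through
the uniformisation to a `C¹` path from some point `z` to `z + w` in `ℂ` minus the lattice. -/
def LoopOf (τ : UpperHalfPlane) (lam : ℂ) (w : ℂ) {P : ℂ × ℂ} (γ : Path P P) : Prop :=
  ∃ (z : ℂ) (p : Path z (z + w)),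
    ContDiffOn ℝ 1 p.extend (Set.Icc 0 1) ∧
    (∀ t, p t ∉ (periodPair τ).lattice) ∧
    ∀ t, γ t = uniformization τ lam (p t)

/-- The form `dx / y`.  (Where `y = 0`, the form on the curve is `2 dy / (12 x² - u)` and this
expression takes the value `0`; along a `C¹` loop on a nonsingular curve this affects the
integrand on a countable set of times at most, hence no integral.) -/
def formOmega (P : ℂ × ℂ) : (ℂ × ℂ) →L[ℂ] ℂ :=
  (P.2)⁻¹ • ContinuousLinearMap.fst ℂ ℂ ℂ

/-- The form `x dx / y`. -/
def formEta (P : ℂ × ℂ) : (ℂ × ℂ) →L[ℂ] ℂ :=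
  (P.1 / P.2) • ContinuousLinearMap.fst ℂ ℂ ℂ

/-- The matrix of periods of `dx / y` (first column) and `x dx / y` (second column) along the
loops `γ₁` (first row) and `γ₂` (second row), that is `!![ω₁, η₁; ω₂, η₂]`. -/
def periodMatrix {P Q : ℂ × ℂ} (γ₁ : Path P P) (γ₂ : Path Q Q) : Matrix (Fin 2) (Fin 2) ℂ :=
  !![curveIntegral formOmega γ₁, curveIntegral formEta γ₁;
     curveIntegral formOmega γ₂, curveIntegral formEta γ₂]

/-- The single-valued period matrix `P̄⁻¹ P` of a period matrix `P`. -/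
def singleValued (A : Matrix (Fin 2) (Fin 2) ℂ) : Matrix (Fin 2) (Fin 2) ℂ :=
  (A.map (starRingEnd ℂ))⁻¹ * A

end UniversalElliptic

end

/-!
The Weierstrass map carries `dx / y` and `x dx / y` to `c dz` and `c⁻¹ ℘(z) dz`, where
`c = 2πiλ`. The first form has primitive `c z`; the second has primitive `-c⁻¹ ζ(z)`, where `ζ` is
the Weierstrass zeta function of the lattice, a single-valued function off the lattice with
`ζ' = -℘`. The periods over the loop of a lattice vector `w` are therefore `c w` and
`-c⁻¹ (ζ(z + w) - ζ(z))` (`LoopOf.curveIntegral_eq`), and everything depends on the two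
quasi-periods of `ζ`.

Summing `ζ(z + w) - ζ(z)` over the rows `mτ + ℤ` of the lattice, the Mittag-Leffler expansion of
the cotangent turns the row `m` into
`π cot π(z + w - mτ) - π cot π(z - mτ) + w ∑ₙ (mτ + n)⁻²` (`hasSum_weierstrassZeta_sub_rows`).
The last terms add up to `w G₂(τ)` in the sense of Eisenstein summation. The cotangents cancel for
`w = 1`, by periodicity, and telescope for `w = τ`, where the limits `∓πi` of `π cot πz` as
`Im z → ±∞` leave `-2πi`. Hence the quasi-periods are `G₂(τ)` and `τ G₂(τ) - 2πi`
(`weierstrassZeta_add_one`, `weierstrassZeta_add_tau`), which contains the Legendre relation, that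
is, `det P = 2πi`. Since `𝔪(τ) = Im(τ) G₂(τ) / π - 1`, the formula for `P̄⁻¹ P` is then matrix
algebra.

That the image of the map lies on the curve is the differential equation of `℘`, with the lattice
sums `G₄`, `G₆` replaced by their `q`-expansions (`G_eq_eisG`).
-/

section

open Filter Topology Complex EisensteinSeries

/-! ### The Weierstrass zeta function -/

namespace PeriodPair

/-- The Weierstrass zeta function `∑ (1 / (z - l) + 1 / l + z / l²)` of a lattice. The term `l = 0`
is `1 / z`, as it should be, because division by zero yields zero. -/
noncomputable def weierstrassZeta (L : PeriodPair) (z : ℂ) : ℂ :=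
  ∑' l : L.lattice, (1 / (z - l) + 1 / l + z / l ^ 2)

variable (L : PeriodPair)

/-- The summand equals `s² / (l² (s - l))`, hence is of order `l⁻³`. -/
lemma norm_weierstrassZeta_summand_le {r : ℝ} (hr : 0 < r) {s : ℂ} (hs : ‖s‖ < r) {l : ℂ}
    (h : 2 * r ≤ ‖l‖) :
    ‖1 / (s - l) + 1 / l + s / l ^ 2‖ ≤ 2 * r ^ 2 * ‖l‖ ^ (-3 : ℝ) := by
  have hl : 0 < ‖l‖ := by linarith
  have hl0 : l ≠ 0 := norm_pos_iff.mp hl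
  have hsl : s - l ≠ 0 := by
    rw [sub_ne_zero]
    rintro rfl
    linarith
  have hdist : ‖l‖ / 2 ≤ ‖s - l‖ := by
    rw [norm_sub_rev]
    exact .trans (by linarith) (norm_sub_norm_le l s)
  calc
    _ = ‖s ^ 2 / (l ^ 2 * (s - l))‖ := by
      congr 1
      field_simp
      ring
    _ = ‖s‖ ^ 2 / (‖l‖ ^ 2 * ‖s - l‖) := by simp
    _ ≤ r ^ 2 / (‖l‖ ^ 2 * (‖l‖ / 2)) := by gcongr
    _ = 2 * r ^ 2 / ‖l‖ ^ 3 := by field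
    _ = _ := by norm_cast

lemma hasSum_weierstrassZeta (z : ℂ) :
    HasSum (fun l : L.lattice ↦ 1 / (z - l) + 1 / l + z / (l : ℂ) ^ 2) (L.weierstrassZeta z) := by
  have : HasSumLocallyUniformly
      (fun (l : L.lattice) (z : ℂ) ↦ 1 / (z - l) + 1 / l + z / (l : ℂ) ^ 2) L.weierstrassZeta := by
    refine L.hasSumLocallyUniformly_aux (u := (2 * · ^ 2 * ‖·‖ ^ (-3 : ℝ))) _
      (fun _ _ ↦ (ZLattice.summable_norm_rpow _ _ (by simp; norm_num)).mul_left _) fun r hr ↦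
      Filter.eventually_atTop.mpr ⟨2 * r, ?_⟩
    rintro _ h s hs l rfl
    exact norm_weierstrassZeta_summand_le hr hs h
  exact this.hasSum

lemma hasDerivAt_weierstrassZeta {z : ℂ} (hz : z ∉ L.lattice) :
    HasDerivAt L.weierstrassZeta (-L.weierstrassP z) z := by
  have hneg : TendstoLocallyUniformlyOn
      (fun (t : Finset L.lattice) (x : ℂ) ↦
        -∑ l ∈ t, (1 / (x - l) ^ 2 - 1 / (l : ℂ) ^ 2))
      (fun x ↦ -L.weierstrassP x) atTop (L.lattice : Set ℂ)ᶜ :=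
    (L.hasSumLocallyUniformly_weierstrassP.tendstoLocallyUniformlyOn
      (s := (L.lattice : Set ℂ)ᶜ)).neg
  refine hasDerivAt_of_tendstoLocallyUniformlyOn L.isClosed_lattice.isOpen_compl hneg
    (l := atTop) (g := L.weierstrassZeta)
    (f := fun (t : Finset L.lattice) x ↦ ∑ l ∈ t, (1 / (x - l) + 1 / (l : ℂ) + x / (l : ℂ) ^ 2))
    (.of_forall fun t x hx ↦ ?_) (fun x _ ↦ by simpa [HasSum] using! L.hasSum_weierstrassZeta x) hz
  rw [← Finset.sum_neg_distrib]
  refine HasDerivAt.fun_sum fun l _ ↦ ?_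
  have hxl : x - l ≠ 0 := by
    rw [sub_ne_zero]
    rintro rfl
    exact hx l.2
  have h := ((((hasDerivAt_id x).sub_const (l : ℂ)).inv hxl).add_const (1 / (l : ℂ))).add
    ((hasDerivAt_id x).div_const ((l : ℂ) ^ 2))
  simp only [id_eq] at h
  convert h using 1
  · ext y; simp
  · simp; ring

/-- By the identity theorem `℘'` would otherwise vanish off the lattice, against its pole at `0`. -/
lemma not_eventually_derivWeierstrassP_eq_zero {a : ℂ} (ha : a ∉ L.lattice) :
    ¬ ∀ᶠ z in 𝓝 a, L.derivWeierstrassP z = 0 := by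
  intro h
  have hconn : IsPreconnected (L.lattice : Set ℂ)ᶜ := by
    refine (Set.Countable.isConnected_compl_of_one_lt_rank (by simp) ?_).2
    exact countable_of_Lindelof_of_discrete (X := L.lattice)
  have hzero := L.analyticOnNhd_derivWeierstrassP.eqOn_zero_of_preconnected_of_eventuallyEq_zero
    hconn ha h
  -- The regular part of `℘'` at `0` would have to be `2 / z ^ 3`.
  have hlim : Tendsto (fun z ↦ z ^ 3 * L.derivWeierstrassPExcept 0 z) (𝓝[≠] 0) (𝓝 0) := by
    have : ContinuousAt (fun z ↦ z ^ 3 * L.derivWeierstrassPExcept 0 z) 0 :=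
      (continuousAt_id.pow 3).mul (L.analyticAt_derivWeierstrassPExcept 0).continuousAt
    simpa using this.tendsto.mono_left nhdsWithin_le_nhds
  have hev : ∀ᶠ z in 𝓝[≠] (0 : ℂ), z ^ 3 * L.derivWeierstrassPExcept 0 z = 2 := by
    filter_upwards [self_mem_nhdsWithin, mem_nhdsWithin_of_mem_nhds
      (L.compl_lattice_sdiff_singleton_mem_nhds 0)] with z hz hz'
    have hzL : z ∉ L.lattice := fun hmem ↦ hz' ⟨hmem, hz⟩
    have h1 := L.derivWeierstrassPExcept_def 0 z
    rw [hzero hzL] at h1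
    have hz0 : z ≠ 0 := hz
    simp at h1
    rw [h1]
    field_simp
  have := tendsto_nhds_unique (hlim.congr' hev) tendsto_const_nhds
  norm_num at this

end PeriodPair

/-! ### Quasi-periods of the zeta function of `ℤ + τℤ` -/

/-- A difference of two Mittag-Leffler expansions of the cotangent. Unlike the single expansions, it
converges unconditionally over `ℤ`; summability is a hypothesis since in the application it comes
from that of the zeta function. -/
lemma hasSum_int_one_div_sub_sub_one_div_sub {a b : ℂ} (ha : a ∈ integerComplement)
    (hb : b ∈ integerComplement)
    (hs : Summable fun n : ℤ ↦ 1 / (a - n) - 1 / (b - n)) :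
    HasSum (fun n : ℤ ↦ 1 / (a - n) - 1 / (b - n))
      (Real.pi * cot (Real.pi * a) - Real.pi * cot (Real.pi * b)) := by
  -- Pair `n` with `-n`; `nat_add_neg` counts the term `n = 0` twice.
  have h1 := hs.hasSum.nat_add_neg
  rw [← hasSum_nat_add_iff' 1] at h1
  have h2 := ((summable_cotTerm ha).hasSum).sub (summable_cotTerm hb).hasSum
  have h3 : (fun n ↦ cotTerm a n - cotTerm b n) = fun n : ℕ ↦
      1 / (a - ((n + 1 : ℕ) : ℤ)) - 1 / (b - ((n + 1 : ℕ) : ℤ)) +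
        (1 / (a - (-((n + 1 : ℕ) : ℤ) : ℤ)) - 1 / (b - (-((n + 1 : ℕ) : ℤ) : ℤ))) := by
    ext n
    simp only [cotTerm]
    push_cast
    ring
  rw [h3] at h2
  have hab := h1.unique h2
  simp only [cotTerm, ← cot_series_rep' ha, ← cot_series_rep' hb] at hab
  convert hs.hasSum using 1
  simp at hab ⊢
  linear_combination -hab

/-- The value `-πi` of `π cot πz` at `q = 0`. -/
lemma tendsto_cot_pi_mul_of_tendsto_exp {α : Type*} {l : Filter α} {f : α → ℂ}
    (h : Tendsto (fun a ↦ exp (2 * Real.pi * I * f a)) l (𝓝 0)) :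
    Tendsto (fun a ↦ Real.pi * cot (Real.pi * f a)) l (𝓝 (-(Real.pi * I))) := by
  simp_rw [cot_pi_eq_exp_ratio]
  rw [show -(Real.pi * I) = (Real.pi : ℂ) * ((0 + 1) / (I * (1 - 0))) by simp]
  exact ((h.add_const 1).div ((h.const_sub 1).const_mul I) (by simp)).const_mul _

lemma tendsto_pi_mul_cot_add_nat_mul (τ : UpperHalfPlane) (x : ℂ) :
    Tendsto (fun N : ℕ ↦ Real.pi * cot (Real.pi * (x + N * (τ : ℂ)))) atTop
      (𝓝 (-(Real.pi * I))) := by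
  apply tendsto_cot_pi_mul_of_tendsto_exp
  have h := (tendsto_pow_atTop_nhds_zero_of_norm_lt_one
    (UpperHalfPlane.norm_exp_two_pi_I_lt_one τ)).const_mul (exp (2 * Real.pi * I * x))
  rw [mul_zero] at h
  refine h.congr fun N ↦ ?_
  rw [← exp_nat_mul, ← exp_add]
  ring_nf

lemma tendsto_pi_mul_cot_sub_nat_mul (τ : UpperHalfPlane) (x : ℂ) :
    Tendsto (fun N : ℕ ↦ Real.pi * cot (Real.pi * (x - N * (τ : ℂ)))) atTop
      (𝓝 (Real.pi * I)) := by
  have h := (tendsto_pi_mul_cot_add_nat_mul τ (-x)).neg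
  rw [neg_neg] at h
  refine h.congr fun N ↦ ?_
  rw [show (Real.pi : ℂ) * (x - N * (τ : ℂ)) = -(Real.pi * (-x + N * τ)) by ring]
  simp [Complex.cot, Complex.sin_neg, Complex.cos_neg, div_neg]

namespace UniversalElliptic

lemma mem_lattice_periodPair {τ : UpperHalfPlane} {z : ℂ} :
    z ∈ (periodPair τ).lattice ↔ ∃ m n : ℤ, (m : ℂ) + n * τ = z := by
  simp [PeriodPair.mem_lattice, periodPair]

/-- Lattice sums as sums over pairs `(m, n)`, standing for `mτ + n` as in `eisSummand`. -/
lemma hasSum_lattice_iff (τ : UpperHalfPlane) (f : ℂ → ℂ) (s : ℂ) :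
    HasSum (fun l : (periodPair τ).lattice ↦ f l) s ↔
      HasSum (fun x : ℤ × ℤ ↦ f (x.1 * τ + x.2)) s := by
  rw [← ((Equiv.prodComm ℤ ℤ).trans (periodPair τ).latticeEquivProd.symm.toEquiv).hasSum_iff]
  refine iff_of_eq (congrArg (HasSum · s) (funext fun x ↦ ?_))
  simp only [Function.comp_apply, Equiv.trans_apply]
  congr 1
  have := (periodPair τ).latticeEquiv_symm_apply (x.2, x.1)
  simp only [periodPair, mul_one] at this
  rw [add_comm, ← this]
  rfl

lemma sub_intCast_mul_mem_integerComplement {τ : UpperHalfPlane} {z : ℂ}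
    (hz : z ∉ (periodPair τ).lattice) (m : ℤ) : z - m * τ ∈ integerComplement := by
  rintro ⟨n, hn⟩
  refine hz (mem_lattice_periodPair.mpr ⟨n, m, ?_⟩)
  simp [hn]

/-- The increment of the zeta function, summed over the rows `mτ + ℤ` of the lattice. -/
lemma hasSum_weierstrassZeta_sub_rows {τ : UpperHalfPlane} {z w : ℂ}
    (hz : z ∉ (periodPair τ).lattice) (hzw : z + w ∉ (periodPair τ).lattice) :
    HasSum (fun m : ℤ ↦ (Real.pi * cot (Real.pi * (z + w - m * τ)) -
        Real.pi * cot (Real.pi * (z - m * τ))) + w * e2Summand m τ)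
      ((periodPair τ).weierstrassZeta (z + w) - (periodPair τ).weierstrassZeta z) := by
  have h := ((periodPair τ).hasSum_weierstrassZeta (z + w)).sub
    ((periodPair τ).hasSum_weierstrassZeta z)
  rw [hasSum_lattice_iff τ (fun l ↦ 1 / (z + w - l) + 1 / l + (z + w) / l ^ 2 -
    (1 / (z - l) + 1 / l + z / l ^ 2))] at h
  refine h.prod_fiberwise fun m ↦ ?_
  -- Off the Eisenstein part, the row consists of differences of cotangent terms.
  have hrow := h.summable.prod_factor m
  have he := (e2Summand_summable m τ).hasSum.mul_left w
  have hterm : ∀ n : ℤ, (1 / (z + w - m * τ - n) - 1 / (z - m * τ - n)) =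
      (1 / (z + w - (m * τ + n)) + 1 / (m * τ + n) + (z + w) / (m * τ + n) ^ 2 -
        (1 / (z - (m * τ + n)) + 1 / (m * τ + n) + z / (m * τ + n) ^ 2)) -
      w * eisSummand 2 ![m, n] τ := by
    intro n
    simp [eisSummand, sub_sub]
    ring
  have hcot := hasSum_int_one_div_sub_sub_one_div_sub
    (sub_intCast_mul_mem_integerComplement hzw m) (sub_intCast_mul_mem_integerComplement hz m)
    ((hrow.sub he.summable).congr fun n ↦ (hterm n).symm)
  convert hcot.add he using 2 with n
  · rw [hterm]
    ring
  · rfl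

/-- The cotangents are separated from the rows of `G2` by summation over symmetric ranges, which is
how `G2` is defined and makes the cotangents telescope for `w = τ`. -/
lemma tendsto_sum_Icc_cot {τ : UpperHalfPlane} {z w : ℂ}
    (hz : z ∉ (periodPair τ).lattice) (hzw : z + w ∉ (periodPair τ).lattice) :
    Tendsto (fun N : ℕ ↦ ∑ m ∈ Finset.Icc (-N : ℤ) N, (Real.pi * cot (Real.pi * (z + w - m * τ)) -
        Real.pi * cot (Real.pi * (z - m * τ)))) atTop
      (𝓝 ((periodPair τ).weierstrassZeta (z + w) - (periodPair τ).weierstrassZeta z -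
        w * G2 τ)) := by
  have h1 : HasSum _ _ (SummationFilter.symmetricIcc ℤ) :=
    (hasSum_weierstrassZeta_sub_rows hz hzw).mono_left (SummationFilter.symmetricIcc ℤ).le_atTop
  have h2 := h1.sub ((summable_e2Summand_symmetricIcc τ).hasSum.mul_left w)
  rw [SummationFilter.hasSum_symmetricIcc_iff] at h2
  simpa only [add_sub_cancel_right] using! h2

lemma weierstrassZeta_add_one {τ : UpperHalfPlane} {z : ℂ} (hz : z ∉ (periodPair τ).lattice)
    (hz1 : z + 1 ∉ (periodPair τ).lattice) :
    (periodPair τ).weierstrassZeta (z + 1) - (periodPair τ).weierstrassZeta z = G2 τ := by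
  have h := tendsto_sum_Icc_cot hz hz1
  have hper : ∀ m : ℤ, cot (Real.pi * (z + 1 - m * τ)) = cot (Real.pi * (z - m * τ)) := by
    intro m
    rw [show (Real.pi : ℂ) * (z + 1 - m * τ) = Real.pi * (z - m * τ) + Real.pi by ring]
    simp [Complex.cot, Complex.sin_add_pi, Complex.cos_add_pi, neg_div_neg_eq]
  simp only [hper, sub_self, Finset.sum_const_zero] at h
  have := tendsto_nhds_unique h tendsto_const_nhds
  linear_combination this

lemma weierstrassZeta_add_tau {τ : UpperHalfPlane} {z : ℂ} (hz : z ∉ (periodPair τ).lattice)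
    (hzτ : z + τ ∉ (periodPair τ).lattice) :
    (periodPair τ).weierstrassZeta (z + τ) - (periodPair τ).weierstrassZeta z =
      τ * G2 τ - 2 * Real.pi * I := by
  have h := tendsto_sum_Icc_cot hz hzτ
  have htel : ∀ N : ℕ, ∑ m ∈ Finset.Icc (-N : ℤ) N, (Real.pi * cot (Real.pi * (z + τ - m * τ)) -
        Real.pi * cot (Real.pi * (z - m * τ))) =
      Real.pi * cot (Real.pi * (z + τ + N * τ)) - Real.pi * cot (Real.pi * (z - N * τ)) := by
    intro N
    induction N with
    | zero => simp
    | succ N ih =>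
      rw [Nat.cast_add, Nat.cast_one, Finset.sum_Icc_succ_eq_add_endpoints, ih]
      push_cast
      rw [show z + τ - (N + 1) * τ = z - N * τ by ring,
        show z + τ - -(N + 1) * τ = z + τ + (N + 1) * τ by ring,
        show z - -(N + 1) * τ = z + τ + N * τ by ring]
      ring
  simp only [htel] at h
  have := tendsto_nhds_unique h ((tendsto_pi_mul_cot_add_nat_mul τ (z + τ)).sub
    (tendsto_pi_mul_cot_sub_nat_mul τ z))
  linear_combination this

end UniversalElliptic

/-! ### Lattice sums and normalised Eisenstein series -/

namespace UniversalElliptic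

lemma G2_eq_eisG_two (τ : UpperHalfPlane) : G2 τ = -8 * Real.pi ^ 2 * eisG 2 τ := by
  rw [G2_eq_tsum_cexp, eisG, riemannZeta_two, bernoulli_two]
  push_cast
  ring

/-- Euler's formula, in the form of the constant term in the `q`-expansion of a lattice sum. -/
lemma two_mul_riemannZeta_eq {k : ℕ} (hk : k ≠ 0) (hk2 : Even k) :
    2 * riemannZeta k =
      2 * ((2 * Real.pi * I) ^ k / (k - 1).factorial) * (-((bernoulli k : ℚ) : ℂ) / (2 * k)) := by
  obtain ⟨j, rfl⟩ := hk2.two_dvd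
  have hj : j ≠ 0 := by omega
  have hfac : ((2 * j).factorial : ℂ) = (2 * j : ℂ) * (2 * j - 1).factorial := by
    rw [← Nat.mul_factorial_pred hk]
    push_cast
    ring
  have hpow : (2 : ℂ) ^ (2 * j) = 2 * 2 ^ (2 * j - 1) := by
    rw [← pow_succ', show 2 * j - 1 + 1 = 2 * j by omega]
  have hf : ((2 * j - 1).factorial : ℂ) ≠ 0 := Nat.cast_ne_zero.mpr (Nat.factorial_ne_zero _)
  have hj' : (j : ℂ) ≠ 0 := Nat.cast_ne_zero.mpr hj
  rw [Nat.cast_mul, Nat.cast_two, riemannZeta_two_mul_nat hj, hfac, mul_pow, mul_pow, hpow,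
    pow_mul I, I_sq]
  field_simp
  ring

lemma G_eq_eisG {k : ℕ} (hk : 3 ≤ k) (hk2 : Even k) (τ : UpperHalfPlane) :
    (periodPair τ).G k = 2 * ((2 * Real.pi * I) ^ k / (k - 1).factorial) * eisG k τ := by
  have h := (periodPair τ).hasSum_sumInvPow 0 (r := k) (by omega)
  rw [hasSum_lattice_iff τ (fun l ↦ ((l - 0) ^ k)⁻¹), PeriodPair.sumInvPow_zero] at h
  have h2 : (periodPair τ).G k = ∑' v, eisSummand k v τ := by
    rw [← h.tsum_eq, ← (finTwoArrowEquiv ℤ).symm.tsum_eq]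
    refine tsum_congr fun x ↦ ?_
    simp [eisSummand]
  rw [h2, tsum_eisSummand_eq_tsum_sigma_mul_cexp_pow hk hk2,
    two_mul_riemannZeta_eq (by omega) hk2, eisG, mul_add,
    show (-2 * (Real.pi : ℂ) * I) = -(2 * Real.pi * I) by ring, hk2.neg_pow]

lemma uniformization_mem_affineCurve (τ : UpperHalfPlane) {lam : ℂ} (hlam : lam ≠ 0) {z : ℂ}
    (hz : z ∉ (periodPair τ).lattice) :
    uniformization τ lam z ∈ affineCurve (coeffU τ lam) (coeffV τ lam) := by
  have hpi : (Real.pi : ℂ) ≠ 0 := ofReal_ne_zero.mpr Real.pi_ne_zero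
  have h := (periodPair τ).derivWeierstrassP_sq z hz
  rw [PeriodPair.g₂, PeriodPair.g₃, G_eq_eisG (by norm_num) (by decide),
    G_eq_eisG (by norm_num) (by decide)] at h
  simp only [affineCurve, uniformization, coeffU, coeffV, Set.mem_ofPred_eq, div_pow, h]
  have hI : I ≠ 0 := I_ne_zero
  norm_num [Nat.factorial]
  field_simp
  ring

end UniversalElliptic

/-! ### Periods as integrals along loops -/

/-- A curve moving with nonzero velocity meets the zeros of `g` at isolated, hence countably many,
times, if these zeros are isolated along the curve. -/
lemma countable_setOf_comp_eq_zero_of_deriv_ne_zero {s : Set ℝ} {g : ℂ → ℂ} {q q' : ℝ → ℂ}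
    (hg : ∀ t ∈ s, ∀ᶠ z in 𝓝[≠] (q t), g z ≠ 0) (hq : ∀ t ∈ s, HasDerivAt q (q' t) t) :
    {t ∈ s | g (q t) = 0 ∧ q' t ≠ 0}.Countable := by
  set S := {t ∈ s | g (q t) = 0 ∧ q' t ≠ 0}
  refine Set.Countable.mono (fun t ht ↦ ?_) (countable_setOfPred_isolated_right_within (s := S))
  refine ⟨ht, ?_⟩
  have h1 : ∀ᶠ y in 𝓝[≠] t, g (q y) ≠ 0 :=
    ((hq t ht.1).tendsto_nhdsNE ht.2.2).eventually (hg t ht.1)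
  have h2 : 𝓝[S ∩ Set.Ioi t] t ≤ 𝓝[≠] t :=
    nhdsWithin_mono t fun y hy ↦ (ne_of_gt hy.2 : y ≠ t)
  rw [← eventually_false_iff_eq_bot]
  filter_upwards [h2 h1, self_mem_nhdsWithin] with y hy hyS
  exact hy hyS.1.2.1

namespace PeriodPair

variable (L : PeriodPair)

lemma hasDerivAt_weierstrassP {z : ℂ} (hz : z ∉ L.lattice) :
    HasDerivAt L.weierstrassP (L.derivWeierstrassP z) z := by
  have h := (L.analyticOnNhd_weierstrassP z hz).differentiableAt.hasDerivAt
  rwa [L.deriv_weierstrassP] at h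

lemma eventually_derivWeierstrassP_ne_zero {z : ℂ} (hz : z ∉ L.lattice) :
    ∀ᶠ w in 𝓝[≠] z, L.derivWeierstrassP w ≠ 0 :=
  (L.analyticOnNhd_derivWeierstrassP z hz).eventually_eq_zero_or_eventually_ne_zero.resolve_left
    (L.not_eventually_derivWeierstrassP_eq_zero hz)

end PeriodPair

namespace UniversalElliptic

/-- The pullbacks of `dx / y` and `x dx / y` are `c dz` and `c⁻¹ ℘ dz`, where `c = 2πiλ`. At a zero of
`℘'` the forms take the junk value `0`, so the formulas need the velocity to vanish there. -/
lemma curveIntegralFun_formOmega_formEta {τ : UpperHalfPlane} {lam : ℂ} (hlam : lam ≠ 0)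
    {P : ℂ × ℂ} {γ : Path P P} {q : ℝ → ℂ} {v : ℂ} {t : ℝ} (ht : t ∈ Set.Ioo (0 : ℝ) 1)
    (hγ : γ.extend = fun t ↦ uniformization τ lam (q t)) (hq : HasDerivAt q v t)
    (hqt : q t ∉ (periodPair τ).lattice)
    (hv : (periodPair τ).derivWeierstrassP (q t) = 0 → v = 0) :
    curveIntegralFun formOmega γ t = 2 * Real.pi * I * lam * v ∧
      curveIntegralFun formEta γ t =
        (2 * Real.pi * I * lam)⁻¹ * ((periodPair τ).weierstrassP (q t) * v) := by
  have hc : 2 * Real.pi * I * lam ≠ 0 := by simp [Real.pi_ne_zero, hlam]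
  have h1 := (((periodPair τ).hasDerivAt_weierstrassP hqt).scomp t hq).div_const
    ((2 * Real.pi * I * lam) ^ 2)
  have h2 := ((((periodPair τ).analyticOnNhd_derivWeierstrassP _ hqt).differentiableAt.hasDerivAt
    ).scomp t hq).div_const ((2 * Real.pi * I * lam) ^ 3)
  have h3 : HasDerivAt γ.extend _ t := hγ ▸ h1.prodMk h2
  rw [curveIntegralFun_def, curveIntegralFun_def,
    derivWithin_of_mem_nhds (Icc_mem_nhds ht.1 ht.2), h3.deriv, hγ]
  simp only [formOmega, formEta, uniformization, smul_apply,
    ContinuousLinearMap.coe_fst', smul_eq_mul]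
  generalize 2 * Real.pi * I * lam = c at *
  by_cases h0 : (periodPair τ).derivWeierstrassP (q t) = 0
  · simp [hv h0]
  · constructor <;> field_simp

/-- The periods along the loop of a lattice vector: both integrands have primitives, `c z` and
`-c⁻¹ ζ(z)`, along the lifted path. -/
lemma LoopOf.curveIntegral_eq {τ : UpperHalfPlane} {lam : ℂ} (hlam : lam ≠ 0) {w : ℂ}
    {P : ℂ × ℂ} {γ : Path P P} (h : LoopOf τ lam w γ) :
    CurveIntegrable formOmega γ ∧ CurveIntegrable formEta γ ∧
      curveIntegral formOmega γ = 2 * Real.pi * I * lam * w ∧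
      ∃ z, z ∉ (periodPair τ).lattice ∧ z + w ∉ (periodPair τ).lattice ∧
        curveIntegral formEta γ = -(2 * Real.pi * I * lam)⁻¹ *
          ((periodPair τ).weierstrassZeta (z + w) - (periodPair τ).weierstrassZeta z) := by
  obtain ⟨z, p, hp, hpL, hγp⟩ := h
  set q : ℝ → ℂ := ⇑p.extend with hqdef
  set v : ℝ → ℂ := derivWithin q (Set.Icc 0 1) with hvdef
  set c : ℂ := 2 * Real.pi * I * lam with hcdef
  have hqL : ∀ t, q t ∉ (periodPair τ).lattice := fun t ↦ hpL _
  have hγ : γ.extend = fun t ↦ uniformization τ lam (q t) := funext fun t ↦ hγp _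
  have hqc : Continuous q := p.continuous_extend
  have hvc : ContinuousOn v (Set.Icc 0 1) :=
    hp.continuousOn_derivWithin (uniqueDiffOn_Icc zero_lt_one) le_rfl
  have hq : ∀ t ∈ Set.Ioo (0 : ℝ) 1, HasDerivAt q (v t) t := fun t ht ↦
    ((hp.differentiableOn one_ne_zero) t (Set.Ioo_subset_Icc_self ht)).hasDerivWithinAt.hasDerivAt
      (Icc_mem_nhds ht.1 ht.2)
  have hPc : Continuous fun t ↦ (periodPair τ).weierstrassP (q t) :=
    continuous_iff_continuousAt.mpr fun t ↦
      ((periodPair τ).hasDerivAt_weierstrassP (hqL t)).continuousAt.comp hqc.continuousAt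
  have hZc : Continuous fun t ↦ (periodPair τ).weierstrassZeta (q t) :=
    continuous_iff_continuousAt.mpr fun t ↦
      ((periodPair τ).hasDerivAt_weierstrassZeta (hqL t)).continuousAt.comp hqc.continuousAt
  have hcount := countable_setOf_comp_eq_zero_of_deriv_ne_zero (s := Set.Ioo (0 : ℝ) 1)
    (fun t _ ↦ (periodPair τ).eventually_derivWeierstrassP_ne_zero (hqL t)) hq
  -- The exceptional times are the endpoint `1` and those where the path crosses a zero of
  -- `℘'` at nonzero velocity.
  have hae : ∀ᵐ t : ℝ, t ∈ Set.uIoc (0 : ℝ) 1 →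
      curveIntegralFun formOmega γ t = c * v t ∧
      curveIntegralFun formEta γ t = c⁻¹ * ((periodPair τ).weierstrassP (q t) * v t) := by
    filter_upwards [hcount.ae_notMem MeasureTheory.volume,
      (Set.countable_singleton (1 : ℝ)).ae_notMem MeasureTheory.volume] with t ht ht1 htI
    rw [Set.uIoc_of_le zero_le_one] at htI
    have htI' : t ∈ Set.Ioo (0 : ℝ) 1 := ⟨htI.1, lt_of_le_of_ne htI.2 ht1⟩
    refine curveIntegralFun_formOmega_formEta hlam htI' hγ (hq t htI') (hqL t) fun h0 ↦ ?_
    by_contra hv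
    exact ht ⟨htI', h0, hv⟩
  have hvi : IntervalIntegrable v MeasureTheory.volume 0 1 :=
    ContinuousOn.intervalIntegrable_of_Icc zero_le_one hvc
  have hPvi : IntervalIntegrable (fun t ↦ (periodPair τ).weierstrassP (q t) * v t)
      MeasureTheory.volume 0 1 :=
    ContinuousOn.intervalIntegrable_of_Icc zero_le_one (hPc.continuousOn.mul hvc)
  have hq0 : q 0 = z := p.extend_zero
  have hq1 : q 1 = z + w := p.extend_one
  have hω : curveIntegral formOmega γ = c * w := by
    rw [curveIntegral_def, intervalIntegral.integral_congr_ae (hae.mono fun t h ht ↦ (h ht).1),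
      intervalIntegral.integral_const_mul,
      intervalIntegral.integral_eq_sub_of_hasDerivAt_of_le zero_le_one hqc.continuousOn hq hvi,
      hq0, hq1, add_sub_cancel_left]
  have hη : curveIntegral formEta γ = -c⁻¹ *
      ((periodPair τ).weierstrassZeta (z + w) - (periodPair τ).weierstrassZeta z) := by
    rw [curveIntegral_def, intervalIntegral.integral_congr_ae (hae.mono fun t h ht ↦ (h ht).2),
      intervalIntegral.integral_const_mul,
      intervalIntegral.integral_eq_sub_of_hasDerivAt_of_le zero_le_one
        (f := fun t ↦ -(periodPair τ).weierstrassZeta (q t)) hZc.neg.continuousOn ?_ hPvi,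
      hq0, hq1]
    · ring
    · intro t ht
      have h := (((periodPair τ).hasDerivAt_weierstrassZeta (hqL t)).scomp t (hq t ht)).neg
      rw [smul_eq_mul, mul_neg, neg_neg, mul_comm] at h
      exact h
  refine ⟨(hvi.const_mul c).congr_ae ?_, (hPvi.const_mul c⁻¹).congr_ae ?_, hω, z,
    hq0 ▸ hqL 0, hq1 ▸ hqL 1, hη⟩
  · rw [Filter.EventuallyEq, MeasureTheory.ae_restrict_iff' measurableSet_uIoc]
    exact hae.mono fun t h ht ↦ (h ht).1.symm
  · rw [Filter.EventuallyEq, MeasureTheory.ae_restrict_iff' measurableSet_uIoc]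
    exact hae.mono fun t h ht ↦ (h ht).2.symm

end UniversalElliptic

/-! ### The single-valued period matrix -/

namespace UniversalElliptic

lemma frakM_eq_G2 (τ : UpperHalfPlane) : frakM τ = τ.im * G2 τ / Real.pi - 1 := by
  have hy : (τ.im : ℂ) ≠ 0 := ofReal_ne_zero.mpr τ.im_ne_zero
  have hpi : (Real.pi : ℂ) ≠ 0 := ofReal_ne_zero.mpr Real.pi_ne_zero
  rw [frakM, eisGTwoStar, G2_eq_eisG_two]
  field_simp
  ring

/-- A matrix `B` with `Ā B = A` is `Ā⁻¹ A`, which avoids computing the inverse. -/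
lemma singleValued_eq_of_map_mul_eq {A B : Matrix (Fin 2) (Fin 2) ℂ} (hA : IsUnit A.det)
    (h : A.map (starRingEnd ℂ) * B = A) : singleValued A = B := by
  have hdet : IsUnit (A.map (starRingEnd ℂ)).det := by
    have := hA.map (starRingEnd ℂ)
    rwa [RingHom.map_det] at this
  calc singleValued A = (A.map (starRingEnd ℂ))⁻¹ * (A.map (starRingEnd ℂ) * B) := by
        rw [h, singleValued]
    _ = B := Matrix.nonsing_inv_mul_cancel_left _ _ hdet

lemma isUnit_det_and_singleValued_eq (τ : UpperHalfPlane) {lam : ℂ} (hlam : lam ≠ 0)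
    {A : Matrix (Fin 2) (Fin 2) ℂ}
    (hA : A = !![2 * Real.pi * I * lam, -(2 * Real.pi * I * lam)⁻¹ * G2 τ;
      2 * Real.pi * I * lam * τ, -(2 * Real.pi * I * lam)⁻¹ * (τ * G2 τ - 2 * Real.pi * I)]) :
    IsUnit A.det ∧ singleValued A =
        !![(starRingEnd ℂ lam)⁻¹, 0; 0, starRingEnd ℂ lam] *
        !![starRingEnd ℂ (frakM τ),
            (4 * Real.pi * (τ.im : ℂ))⁻¹ * (frakM τ * starRingEnd ℂ (frakM τ) - 1);
          -(4 * Real.pi * (τ.im : ℂ)), -frakM τ] *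
        !![lam, 0; 0, lam⁻¹] := by
  have hy : (τ.im : ℂ) ≠ 0 := ofReal_ne_zero.mpr τ.im_ne_zero
  have hpi : (Real.pi : ℂ) ≠ 0 := ofReal_ne_zero.mpr Real.pi_ne_zero
  have hI : I ≠ 0 := I_ne_zero
  have hlam' : starRingEnd ℂ lam ≠ 0 := by simpa using hlam
  have hτ : starRingEnd ℂ (τ : ℂ) = τ - 2 * I * τ.im := by
    have := sub_conj (τ : ℂ)
    rw [UpperHalfPlane.coe_im] at this
    push_cast at this
    linear_combination -this
  have h2 : starRingEnd ℂ 2 = 2 := map_ofNat _ 2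
  have hdet : A.det = 2 * Real.pi * I := by
    rw [hA, Matrix.det_fin_two_of]
    field_simp
    ring
  have hunit : IsUnit A.det := by
    rw [hdet, isUnit_iff_ne_zero]
    simp [Real.pi_ne_zero]
  refine ⟨hunit, singleValued_eq_of_map_mul_eq hunit ?_⟩
  rw [frakM_eq_G2, hA]
  ext i j
  fin_cases i <;> fin_cases j <;>
    simp [Matrix.mul_apply, Fin.sum_univ_two, hτ, h2, conj_ofReal] <;>
    field_simp <;> ring

end UniversalElliptic

end

theorem mainTheorem11 (τ : UpperHalfPlane) (lam : ℂ) (hlam : lam ≠ 0) :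
    (∀ z : ℂ, z ∉ (UniversalElliptic.periodPair τ).lattice →
      UniversalElliptic.uniformization τ lam z ∈
        UniversalElliptic.affineCurve
          (UniversalElliptic.coeffU τ lam) (UniversalElliptic.coeffV τ lam)) ∧
    ∀ (P Q : ℂ × ℂ) (γ₁ : Path P P) (γ₂ : Path Q Q),
      UniversalElliptic.LoopOf τ lam 1 γ₁ →
      UniversalElliptic.LoopOf τ lam (τ : ℂ) γ₂ →
      (CurveIntegrable UniversalElliptic.formOmega γ₁ ∧
        CurveIntegrable UniversalElliptic.formEta γ₁ ∧
        CurveIntegrable UniversalElliptic.formOmega γ₂ ∧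
        CurveIntegrable UniversalElliptic.formEta γ₂) ∧
      UniversalElliptic.periodMatrix γ₁ γ₂ 0 0 = lam * (2 * Real.pi * Complex.I) ∧
      UniversalElliptic.periodMatrix γ₁ γ₂ 1 0 =
        (τ : ℂ) * UniversalElliptic.periodMatrix γ₁ γ₂ 0 0 ∧
      IsUnit (UniversalElliptic.periodMatrix γ₁ γ₂).det ∧
      UniversalElliptic.singleValued (UniversalElliptic.periodMatrix γ₁ γ₂) =
        !![(starRingEnd ℂ lam)⁻¹, 0; 0, starRingEnd ℂ lam] *
        !![starRingEnd ℂ (UniversalElliptic.frakM τ),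
            (4 * Real.pi * (τ.im : ℂ))⁻¹ *
              (UniversalElliptic.frakM τ * starRingEnd ℂ (UniversalElliptic.frakM τ) - 1);
          -(4 * Real.pi * (τ.im : ℂ)), -UniversalElliptic.frakM τ] *
        !![lam, 0; 0, lam⁻¹] := by
  refine ⟨fun z hz ↦ UniversalElliptic.uniformization_mem_affineCurve τ hlam hz,
    fun P Q γ₁ γ₂ h₁ h₂ ↦ ?_⟩
  obtain ⟨hω₁, hη₁, hIω₁, z₁, hz₁, hz₁', hIη₁⟩ := h₁.curveIntegral_eq hlam
  obtain ⟨hω₂, hη₂, hIω₂, z₂, hz₂, hz₂', hIη₂⟩ := h₂.curveIntegral_eq hlam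
  rw [UniversalElliptic.weierstrassZeta_add_one hz₁ hz₁'] at hIη₁
  rw [UniversalElliptic.weierstrassZeta_add_tau hz₂ hz₂'] at hIη₂
  refine ⟨⟨hω₁, hη₁, hω₂, hη₂⟩, ?_, ?_,
    UniversalElliptic.isUnit_det_and_singleValued_eq τ hlam ?_⟩
  · simp only [UniversalElliptic.periodMatrix, Matrix.of_apply, Matrix.cons_val',
      Matrix.cons_val_zero, hIω₁]
    ring
  · simp [UniversalElliptic.periodMatrix, hIω₁, hIω₂]
    ring
  · rw [UniversalElliptic.periodMatrix, hIω₁, hIω₂, hIη₁, hIη₂, mul_one]
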